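/- \textbf{Theorem.} Let $X$ be a proper metric space (closed bounded sets are compact) with its metric coarse proximity structure, and let $\nu X$ be its Higson corona. Then $$\Delta_c(X)\;\ge\;\Delta(\nu X),$$ where both sides take values in $\{-1,0,1,2,\dots,\infty\}$ and the notions involved are as follows. \emph{Metric coarse proximity.} Bounded subsets of $X$ are the metrically bounded ones, and $A\,\mathbf b\,B$ holds iff there is $\epsilon<\infty$ such that for every bounded $D\subseteq X$ there are $a\in A\setminus D$, $b\in B\setminus D$ with $d(a,b)<\epsilon$. Write $C\ll A$ if $C\,\mathbf b\,(X\setminus A)$ fails; $A\sqsubseteq C$ if $A\,\mathbf b\,D$ implies $C\,\mathbf b\,D$ for all $D\subseteq X$; and $A\ll_w C$ if $A\ll D\sqsubseteq C$ for some $D\subseteq X$. \emph{Boundary and traces.} Let $\mathfrak X$ be the Smirnov compactification (the space of clusters) of the proximity $A\,\delta\,B\iff A\cap B\ne\emptyset$ or $A\,\mathbf b\,B$ on the set $X$. The boundary $\mathcal UX\subseteq\mathfrak X$ is the subspace of the clusters containing no bounded set, and $tr(A)=cl_{\mathfrak X}(A)\cap\mathcal UX$ for $A\subseteq X$. A finite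 collection $\{A_1,\dots,A_k\}$ of subsets of $X$ \emph{diverges} if $\bigcup_i tr(X\setminus A_i)=\mathcal UX$ and there are $D_1,\dots,D_k\subseteq X$ with $D_i\ll X\setminus A_i$ for each $i$ and $\bigcup_i tr(D_i)=\mathcal UX$. \emph{Covers.} A \emph{$\mathbf b$-cover} of $X$ is a finite cover $\{A_1,\dots,A_n\}$ of $X$ with exactly one (possibly empty) bounded member, for which there are sets $C_1,\dots,C_n$ covering $X$ with $C_i\ll A_i$ for each $i$. A \emph{coarsely canonical cover} of $X$ is a finite collection $\{A_1,\dots,A_n\}$ of pairwise disjoint sets with union $X$ such that: exactly one member (possibly empty) is bounded; for every unbounded $A_i$ there is an unbounded $K$ with $K\ll_w A_i$; for $i\ne j$ there is no unbounded $K$ with $K\ll_w A_i$ and $K\ll_w A_j$; and whenever $K$ is unbounded and $K\ll D$, there are an unbounded $C$ and an $i$ with $C\ll D$ and $C\ll_w A_i$. Its \emph{order} is the least natural number $m$ such that any $m+1$ distinct members diverge. A collection $\mathcal V$ \emph{coarsely refines} $\mathcal U$ if for each unbounded $C\in\mathcal V$ there are an unbounded $A\in\mathcal U$ and a bounded $B$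 with $C\setminus B\subseteq A$. \emph{Coarse cofinal dimension.} $\Delta_c(X)=-1$ if $X$ is bounded. Otherwise $\Delta_c(X)$ is the least integer $n\ge0$ for which there is a family $\{\mathcal F_\alpha\}_{\alpha\in\Omega}$ of coarsely canonical covers of $X$ of order at most $n+1$, indexed by a nonempty directed (pre)ordered set $\Omega$, which is directed ($\alpha\le\beta$ implies that $\mathcal F_\beta$ coarsely refines $\mathcal F_\alpha$) and fine (every $\mathbf b$-cover of $X$ is coarsely refined by some $\mathcal F_\alpha$); $\Delta_c(X)=\infty$ if there is no such $n$. \emph{Higson corona.} A bounded continuous $f:X\to\mathbb R$ is a Higson function if for all $R,\epsilon>0$ there is a compact $K\subseteq X$ with $|f(x)-f(y)|<\epsilon$ whenever $x\notin K$ and $d(x,y)\le R$. The Higson compactification is the closure of the image of $X$ under the evaluation map into the product of copies of $\mathbb R$ indexed by the Higson functions, and $\nu X$ is the complement of the image of $X$ in it. \emph{Cofinal dimension.} A \emph{canonical cover} of a topological space $Y$ is a locally finite closed cover $\{F_\lambda\}$ for which there are pairwise disjoint open sets $U_\lambda$ with $F_\lambda=cl(U_\lambda)$; its \emph{order} is the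 largest number of its members having a common point. $\Delta(Y)=-1$ if $Y=\emptyset$. Otherwise $\Delta(Y)$ is the least integer $n\ge 0$ for which there is a family $\{\mathcal F_\alpha\}_{\alpha\in\Omega}$ of canonical covers of $Y$ of order at most $n+1$, indexed by a nonempty directed (pre)ordered set, such that $\alpha\le\beta$ implies that $\mathcal F_\beta$ refines $\mathcal F_\alpha$, and every open cover of $Y$ is refined by some $\mathcal F_\alpha$; $\Delta(Y)=\infty$ if there is no such $n$. -/

import Mathlib

open Set Topology

universe u

/-! ## Proximity spaces and the Smirnov compactification -/

/-- A proximity relation on a set `X`. -/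
structure Proximity (X : Type u) where
  near : Set X → Set X → Prop
  not_near_empty : ∀ A, ¬ near A ∅
  symm : ∀ A B, near A B → near B A
  of_inter_nonempty : ∀ A B, (A ∩ B).Nonempty → near A B
  near_union_iff : ∀ A B C, near A (B ∪ C) ↔ near A B ∨ near A C
  strong : ∀ A B, ¬ near A B → ∃ E, ¬ near A Eᶜ ∧ ¬ near E B

namespace Proximity

variable {X : Type u} (δ : Proximity X)

theorem near_mono_right {A B C : Set X} (h : δ.near A B) (hBC : B ⊆ C) : δ.near A C := by
  have := (δ.near_union_iff A B C).2 (Or.inl h)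
  rwa [union_eq_self_of_subset_left hBC] at this

theorem near_mono_left {A B C : Set X} (h : δ.near A B) (hAC : A ⊆ C) : δ.near C B :=
  δ.symm _ _ (δ.near_mono_right (δ.symm _ _ h) hAC)

/-- The topology induced by a proximity: the closure of `A` is `{x | {x} δ A}`, so that `A` is
closed if and only if `{x} δ A` implies `x ∈ A`. -/
abbrev inducedTopology : TopologicalSpace X :=
  TopologicalSpace.ofClosed {A | ∀ x, δ.near {x} A → x ∈ A}
    (fun x h => (δ.not_near_empty _ h).elim)
    (fun S hS x h A hA => hS hA x (δ.near_mono_right h (sInter_subset_of_mem hA)))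
    (fun A hA B hB x h => by
      rcases (δ.near_union_iff _ _ _).1 h with h | h
      · exact Or.inl (hA x h)
      · exact Or.inr (hB x h))

/-- A cluster of a proximity space. -/
@[ext]
structure Cluster where
  sets : Set (Set X)
  nonempty : sets.Nonempty
  near_of_mem : ∀ A ∈ sets, ∀ B ∈ sets, δ.near A B
  mem_or_mem : ∀ A B, A ∪ B ∈ sets → A ∈ sets ∨ B ∈ sets
  mem_of_near : ∀ C, (∀ A ∈ sets, δ.near C A) → C ∈ sets

variable {δ}

theorem Cluster.mem_mono (σ : δ.Cluster) {A B : Set X} (hA : A ∈ σ.sets) (h : A ⊆ B) :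
    B ∈ σ.sets :=
  σ.mem_of_near B fun C hC => δ.near_mono_left (σ.near_of_mem A hA C hC) h

theorem Cluster.univ_mem (σ : δ.Cluster) : univ ∈ σ.sets := by
  obtain ⟨A, hA⟩ := σ.nonempty
  exact σ.mem_mono hA (subset_univ A)

variable (δ)

/-- The point cluster of `x`. -/
def pointCluster (x : X) : δ.Cluster where
  sets := {A | δ.near {x} A}
  nonempty := ⟨{x}, δ.of_inter_nonempty _ _ (by simp)⟩
  near_of_mem := by
    intro A hA B hB
    by_contra h
    obtain ⟨E, hE, hE'⟩ := δ.strong A B h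
    by_cases hx : x ∈ E
    · exact hE' (δ.near_mono_left hB (by simpa using hx))
    · exact hE (δ.symm _ _ (δ.near_mono_left hA (by simpa using hx)))
  mem_or_mem := fun A B h => (δ.near_union_iff _ _ _).1 h
  mem_of_near := fun C h =>
    δ.symm _ _ (h {x} (δ.of_inter_nonempty _ _ (by simp)))

/-- `A` absorbs a collection of clusters if it belongs to each of them. -/
def Absorbs (A : Set X) (𝒜 : Set δ.Cluster) : Prop := ∀ σ ∈ 𝒜, A ∈ σ.sets

/-- The proximity on the set of all clusters: `𝒜 δ* ℬ` if and only if `A δ B` for all absorbing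
sets `A` of `𝒜` and `B` of `ℬ`. -/
def smirnov : Proximity δ.Cluster where
  near 𝒜 ℬ := ∀ A B, δ.Absorbs A 𝒜 → δ.Absorbs B ℬ → δ.near A B
  not_near_empty := fun 𝒜 h =>
    δ.not_near_empty univ (h univ ∅ (fun σ _ => σ.univ_mem) (fun σ hσ => hσ.elim))
  symm := fun 𝒜 ℬ h A B hA hB => δ.symm _ _ (h B A hB hA)
  of_inter_nonempty := by
    rintro 𝒜 ℬ ⟨σ, h1, h2⟩ A B hA hB
    exact σ.near_of_mem A (hA σ h1) B (hB σ h2)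
  near_union_iff := by
    intro 𝒜 ℬ 𝒞
    constructor
    · intro h
      by_contra hcon
      push Not at hcon
      obtain ⟨⟨A, B, hA, hB, hn⟩, A', C, hA', hC, hn'⟩ := hcon
      by_cases hd : ∃ D, δ.Absorbs D 𝒜 ∧ ¬ δ.near D B ∧ ¬ δ.near D C
      · obtain ⟨D, hD, h1, h2⟩ := hd
        have := h D (B ∪ C) hD (by
          rintro σ (hσ | hσ)
          · exact σ.mem_mono (hB σ hσ) subset_union_left
          · exact σ.mem_mono (hC σ hσ) subset_union_right)
        rcases (δ.near_union_iff _ _ _).1 this with h | h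
        exacts [h1 h, h2 h]
      · apply hd
        obtain ⟨E, hE, hE'⟩ := δ.strong A B hn
        obtain ⟨E', hF, hF'⟩ := δ.strong A' C hn'
        refine ⟨E ∩ E', ?_, fun h => hE' (δ.near_mono_left h inter_subset_left),
          fun h => hF' (δ.near_mono_left h inter_subset_right)⟩
        intro σ hσ
        have hu : (E ∩ E') ∪ (Eᶜ ∪ E'ᶜ) ∈ σ.sets := by
          rw [← compl_inter, union_compl_self]
          exact σ.univ_mem
        rcases σ.mem_or_mem _ _ hu with h | h
        · exact h
        · rcases σ.mem_or_mem _ _ h with h | h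
          · exact (hE (σ.near_of_mem _ (hA σ hσ) _ h)).elim
          · exact (hF (σ.near_of_mem _ (hA' σ hσ) _ h)).elim
    · rintro (h | h) A B hA hB
      · exact h A B hA fun σ hσ => hB σ (Or.inl hσ)
      · exact h A B hA fun σ hσ => hB σ (Or.inr hσ)
  strong := by
    intro 𝒜 ℬ h
    push Not at h
    obtain ⟨A, B, hA, hB, hn⟩ := h
    obtain ⟨E, hE, hE'⟩ := δ.strong A B hn
    refine ⟨{σ | E ∈ σ.sets}, fun h => hE (h A Eᶜ hA ?_), fun h => hE' (h E B ?_ hB)⟩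
    · intro σ hσ
      have hu : E ∪ Eᶜ ∈ σ.sets := by
        rw [union_compl_self]
        exact σ.univ_mem
      exact (σ.mem_or_mem _ _ hu).resolve_left hσ
    · exact fun σ hσ => hσ

/-- The set of clusters with this topology is the Smirnov compactification. -/
instance : TopologicalSpace δ.Cluster := δ.smirnov.inducedTopology

end Proximity

/-! ## Coarse proximity spaces -/

/-- A coarse proximity on a set `X` with a bornology. -/
structure CoarseProximity (X : Type u) [Bornology X] where
  near : Set X → Set X → Prop
  symm : ∀ A B, near A B → near B A
  unbounded_of_near : ∀ A B, near A B → ¬ Bornology.IsBounded A ∧ ¬ Bornology.IsBounded B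
  of_inter_unbounded : ∀ A B, ¬ Bornology.IsBounded (A ∩ B) → near A B
  union_near_iff : ∀ A B C, near (A ∪ B) C ↔ near A C ∨ near B C
  strong : ∀ A B, ¬ near A B → ∃ E, ¬ near A E ∧ ¬ near Eᶜ B

namespace CoarseProximity

variable {X : Type u} [Bornology X] (P : CoarseProximity X)

theorem near_mono_left {A B C : Set X} (h : P.near A B) (hAC : A ⊆ C) : P.near C B := by
  have := (P.union_near_iff A C B).2 (Or.inl h)
  rwa [union_eq_self_of_subset_left hAC] at this

theorem near_mono_right {A B C : Set X} (h : P.near A B) (hBC : B ⊆ C) : P.near A C :=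
  P.symm _ _ (P.near_mono_left (P.symm _ _ h) hBC)

theorem near_union_iff (A B C : Set X) : P.near A (B ∪ C) ↔ P.near A B ∨ P.near A C := by
  have h := P.union_near_iff B C A
  constructor
  · intro h1
    exact (h.1 (P.symm _ _ h1)).imp (P.symm _ _) (P.symm _ _)
  · intro h1
    exact P.symm _ _ (h.2 (h1.imp (P.symm _ _) (P.symm _ _)))

/-- `C ≪ A`: the set `A` is a coarse neighbourhood of `C`. -/
def CoarseNhd (C A : Set X) : Prop := ¬ P.near C Aᶜ

/-- `A ⊑ C`: the set `A` is a coarse subset of `C`. -/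
def CoarseSubset (A C : Set X) : Prop := ∀ D, P.near A D → P.near C D

/-- `A ≪_w C`: the set `C` is a weak coarse neighbourhood of `A`. -/
def WeakCoarseNhd (A C : Set X) : Prop := ∃ D, P.CoarseNhd A D ∧ P.CoarseSubset D C

/-- The discrete extension of a coarse proximity. -/
def discreteExtension : Proximity X where
  near A B := (A ∩ B).Nonempty ∨ P.near A B
  not_near_empty := by
    rintro A (h | h)
    · simp at h
    · exact (P.unbounded_of_near _ _ h).2 Bornology.isBounded_empty
  symm := by
    rintro A B (h | h)
    · exact Or.inl (by rwa [inter_comm])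
    · exact Or.inr (P.symm _ _ h)
  of_inter_nonempty := fun A B h => Or.inl h
  near_union_iff := by
    intro A B C
    rw [inter_union_distrib_left, union_nonempty, P.near_union_iff]
    tauto
  strong := by
    intro A B h
    push Not at h
    obtain ⟨h1, h2⟩ := h
    obtain ⟨E, hE, hE'⟩ := P.strong A B h2
    refine ⟨(Eᶜ ∪ A) \ B, ?_, ?_⟩
    · rintro (⟨x, hxA, hx⟩ | h)
      · exact hx ⟨Or.inr hxA, fun hxB => (h1 ▸ (⟨hxA, hxB⟩ : x ∈ A ∩ B) : x ∈ (∅ : Set X))⟩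
      · have hs : ((Eᶜ ∪ A) \ B)ᶜ ⊆ E ∪ B := by
          intro x hx
          by_contra hc
          simp only [mem_union, not_or] at hc
          exact hx ⟨Or.inl hc.1, hc.2⟩
        rcases (P.near_union_iff _ _ _).1 (P.near_mono_right h hs) with h | h
        exacts [hE h, h2 h]
    · rintro (⟨x, hx, hxB⟩ | h)
      · exact hx.2 hxB
      · rcases (P.union_near_iff _ _ _).1 (P.near_mono_left h Set.sdiff_subset) with h | h
        exacts [hE' h, h2 h]

/-- The boundary of a coarse proximity space: the subspace of the Smirnov compactification of the
discrete extension formed by the clusters that contain no bounded set. -/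
abbrev Boundary : Type u :=
  {σ : P.discreteExtension.Cluster // ∀ B ∈ σ.sets, ¬ Bornology.IsBounded B}

/-- The trace of `A` on the boundary: the closure of `A` in the Smirnov compactification,
intersected with the boundary. -/
def trace (A : Set X) : Set P.Boundary :=
  {σ | σ.1 ∈ closure (P.discreteExtension.pointCluster '' A)}

/-- Divergent families of subsets (used for finite families). -/
def Divergent (𝒜 : Set (Set X)) : Prop :=
  (⋃ A ∈ 𝒜, P.trace Aᶜ) = univ ∧
    ∃ D : Set X → Set X, (∀ A ∈ 𝒜, P.CoarseNhd (D A) Aᶜ) ∧ (⋃ A ∈ 𝒜, P.trace (D A)) = univ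

/-- Coarse covers (`b`-covers): finite covers with exactly one (possibly empty) bounded member which can be
shrunk, with respect to `≪`, to a cover. -/
structure IsBCover (𝒰 : Set (Set X)) : Prop where
  finite : 𝒰.Finite
  unique_bounded : ∃! B, B ∈ 𝒰 ∧ Bornology.IsBounded B
  cover : ⋃₀ 𝒰 = univ
  shrink : ∃ C : Set X → Set X, (⋃ A ∈ 𝒰, C A) = univ ∧ ∀ A ∈ 𝒰, P.CoarseNhd (C A) A

/-- Coarsely canonical covers. -/
structure IsCoarselyCanonicalCover (𝒜 : Set (Set X)) : Prop where
  finite : 𝒜.Finite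
  disjoint : 𝒜.PairwiseDisjoint id
  unique_bounded : ∃! B, B ∈ 𝒜 ∧ Bornology.IsBounded B
  cover : ⋃₀ 𝒜 = univ
  exists_weakCoarseNhd : ∀ A ∈ 𝒜, ¬ Bornology.IsBounded A →
    ∃ K, ¬ Bornology.IsBounded K ∧ P.WeakCoarseNhd K A
  not_common : ∀ A ∈ 𝒜, ∀ A' ∈ 𝒜, A ≠ A' →
    ¬ ∃ K, ¬ Bornology.IsBounded K ∧ P.WeakCoarseNhd K A ∧ P.WeakCoarseNhd K A'
  dense : ∀ K D, ¬ Bornology.IsBounded K → P.CoarseNhd K D →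
    ∃ C, ∃ A ∈ 𝒜, ¬ Bornology.IsBounded C ∧ P.CoarseNhd C D ∧ P.WeakCoarseNhd C A

/-- The order of a (finite) collection of subsets: the least `m` such that any `m + 1` of its
members diverge. The set below contains the cardinality of `𝒜`. -/
noncomputable def coarseOrder (𝒜 : Set (Set X)) : ℕ :=
  sInf {m : ℕ | ∀ S ⊆ 𝒜, S.encard = m + 1 → P.Divergent S}

end CoarseProximity

/-- `𝒱` coarsely refines `𝒰`. -/
def CoarselyRefines {X : Type u} [Bornology X] (𝒱 𝒰 : Set (Set X)) : Prop :=
  ∀ C ∈ 𝒱, ¬ Bornology.IsBounded C →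
    ∃ A ∈ 𝒰, ¬ Bornology.IsBounded A ∧ ∃ B, Bornology.IsBounded B ∧ C \ B ⊆ A

namespace CoarseProximity

variable {X : Type u} [Bornology X] (P : CoarseProximity X)

/-- `X` admits a fine directed system of coarsely canonical covers of order at most `n + 1`. -/
def CoarseCofinalDimLE (n : ℕ) : Prop :=
  ∃ (Ω : Type u) (_ : Preorder Ω) (𝓕 : Ω → Set (Set X)),
    Nonempty Ω ∧ (∀ α β : Ω, ∃ γ, α ≤ γ ∧ β ≤ γ) ∧
    (∀ α, P.IsCoarselyCanonicalCover (𝓕 α)) ∧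
    (∀ α β, α ≤ β → CoarselyRefines (𝓕 β) (𝓕 α)) ∧
    (∀ 𝒰, P.IsBCover 𝒰 → ∃ α, CoarselyRefines (𝓕 α) 𝒰) ∧
    (∀ α, P.coarseOrder (𝓕 α) ≤ n + 1)

open Classical in
/-- The coarse cofinal dimension, with values in `{-1, 0, 1, …, ∞}`. -/
noncomputable def coarseCofinalDim : WithTop ℤ :=
  if Bornology.IsBounded (univ : Set X) then ((-1 : ℤ) : WithTop ℤ)
  else if ∃ n, P.CoarseCofinalDimLE n then (((sInf {n | P.CoarseCofinalDimLE n} : ℕ) : ℤ) : WithTop ℤ)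
  else ⊤

end CoarseProximity

/-! ## The metric coarse proximity -/

/-- Coarse closeness of subsets of a metric space. -/
def MetricCoarselyNear {X : Type u} [MetricSpace X] (A B : Set X) : Prop :=
  ∃ ε : ℝ, ∀ D : Set X, Bornology.IsBounded D → ∃ a ∈ A \ D, ∃ b ∈ B \ D, dist a b < ε

theorem MetricCoarselyNear.symm {X : Type u} [MetricSpace X] {A B : Set X}
    (h : MetricCoarselyNear A B) : MetricCoarselyNear B A := by
  obtain ⟨ε, h⟩ := h
  refine ⟨ε, fun D hD => ?_⟩
  obtain ⟨a, ha, b, hb, hab⟩ := h D hD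
  exact ⟨b, hb, a, ha, by rwa [dist_comm]⟩

theorem MetricCoarselyNear.not_bounded {X : Type u} [MetricSpace X] {A B : Set X}
    (h : MetricCoarselyNear A B) : ¬ Bornology.IsBounded A := by
  obtain ⟨ε, h⟩ := h
  intro hA
  obtain ⟨a, ha, -⟩ := h A hA
  exact ha.2 ha.1

theorem MetricCoarselyNear.mono {X : Type u} [MetricSpace X] {A A' B : Set X}
    (h : MetricCoarselyNear A B) (hA : A ⊆ A') : MetricCoarselyNear A' B := by
  obtain ⟨ε, h⟩ := h
  refine ⟨ε, fun D hD => ?_⟩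
  obtain ⟨a, ha, b, hb, hab⟩ := h D hD
  exact ⟨a, ⟨hA ha.1, ha.2⟩, b, hb, hab⟩

/-- If `E` is everywhere at least as close to `B` as to `A`, then nearness of `A` and `E` forces
nearness of `A` and `B`. -/
theorem MetricCoarselyNear.of_approx {X : Type u} [MetricSpace X] {A B E : Set X}
    (h : MetricCoarselyNear A E)
    (hE : ∀ e ∈ E, ∀ a ∈ A, ∃ b ∈ B, dist e b < dist e a + 1) : MetricCoarselyNear A B := by
  obtain ⟨ε, h⟩ := h
  refine ⟨ε + (ε + 1), fun D hD => ?_⟩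
  obtain ⟨a, ha, e, he, hae⟩ := h (Metric.cthickening (ε + 1) D) hD.cthickening
  obtain ⟨b, hb, heb⟩ := hE e he.1 a ha.1
  have hpos : 0 ≤ dist a e := dist_nonneg
  have hsub : D ⊆ Metric.cthickening (ε + 1) D := Metric.self_subset_cthickening D
  rw [dist_comm e a] at heb
  refine ⟨a, ⟨ha.1, fun hc => ha.2 (hsub hc)⟩, b, ⟨hb, fun hc => he.2 ?_⟩, ?_⟩
  · exact Metric.mem_cthickening_of_dist_le e b (ε + 1) D hc (by linarith)
  · linarith [dist_triangle a e b]

/-- The metric coarse proximity of a metric space. -/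
def metricCoarseProximity (X : Type u) [MetricSpace X] : CoarseProximity X where
  near := MetricCoarselyNear
  symm := fun A B h => h.symm
  unbounded_of_near := fun A B h => ⟨h.not_bounded, h.symm.not_bounded⟩
  of_inter_unbounded := by
    intro A B h
    refine ⟨1, fun D hD => ?_⟩
    have : ((A ∩ B) \ D).Nonempty := by
      by_contra hc
      rw [not_nonempty_iff_eq_empty, Set.sdiff_eq_empty] at hc
      exact h (hD.subset hc)
    obtain ⟨x, hx, hxD⟩ := this
    exact ⟨x, ⟨hx.1, hxD⟩, x, ⟨hx.2, hxD⟩, by simp⟩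
  union_near_iff := by
    intro A B C
    constructor
    · rintro ⟨ε, h⟩
      by_contra hcon
      push Not at hcon
      obtain ⟨hA, hB⟩ := hcon
      have hA' : ∃ D : Set X, Bornology.IsBounded D ∧
          ¬ ∃ a ∈ A \ D, ∃ b ∈ C \ D, dist a b < ε := by
        by_contra hc
        exact hA ⟨ε, fun D hD => by_contra fun hd => hc ⟨D, hD, hd⟩⟩
      have hB' : ∃ D : Set X, Bornology.IsBounded D ∧
          ¬ ∃ a ∈ B \ D, ∃ b ∈ C \ D, dist a b < ε := by
        by_contra hc
        exact hB ⟨ε, fun D hD => by_contra fun hd => hc ⟨D, hD, hd⟩⟩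
      obtain ⟨D, hD, h1⟩ := hA'
      obtain ⟨D', hD', h2⟩ := hB'
      obtain ⟨a, ⟨ha, haD⟩, c, ⟨hc, hcD⟩, hac⟩ := h (D ∪ D') (hD.union hD')
      simp only [mem_union, not_or] at haD hcD
      rcases ha with ha | ha
      · exact h1 ⟨a, ⟨ha, haD.1⟩, c, ⟨hc, hcD.1⟩, hac⟩
      · exact h2 ⟨a, ⟨ha, haD.2⟩, c, ⟨hc, hcD.2⟩, hac⟩
    · rintro (h | h)
      · exact h.mono subset_union_left
      · exact h.mono subset_union_right
  strong := by
    intro A B h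
    refine ⟨{e | ∀ a ∈ A, ∃ b ∈ B, dist e b < dist e a + 1},
      fun hc => h (hc.of_approx fun e he => he), fun hc => h ?_⟩
    refine (hc.symm.of_approx (B := A) fun e he b hb => ?_).symm
    simp only [mem_compl_iff, mem_ofPred_eq, not_forall, not_exists, not_and, not_lt] at he
    obtain ⟨a, ha, hab⟩ := he
    exact ⟨a, ha, by linarith [hab b hb]⟩

/-! ## The Higson corona -/

/-- Higson functions: bounded continuous real functions whose variation over balls of any fixed
radius vanishes at infinity. -/
def higsonFunctions (X : Type u) [MetricSpace X] : Set (BoundedContinuousFunction X ℝ) :=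
  {f | ∀ R > 0, ∀ ε > 0, ∃ K : Set X, IsCompact K ∧
    ∀ x ∉ K, ∀ y, dist x y ≤ R → |f x - f y| < ε}

/-- The evaluation map of `X` into the product of copies of `ℝ` indexed by the Higson functions. -/
def higsonEval (X : Type u) [MetricSpace X] (x : X) : higsonFunctions X → ℝ := fun f => f.1 x

/-- The Higson compactification: the closure of the image of the evaluation map in the product. -/
def higsonCompactification (X : Type u) [MetricSpace X] : Set (higsonFunctions X → ℝ) :=
  closure (range (higsonEval X))

/-- The Higson corona `νX`: the remainder of the Higson compactification. -/
abbrev HigsonCorona (X : Type u) [MetricSpace X] : Type u :=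
  ↥(higsonCompactification X \ range (higsonEval X))

/-! ## Cofinal dimension -/

/-- Canonical covers of a topological space: locally finite closed covers whose members are the
closures of the members of a disjoint family of open sets. -/
structure IsCanonicalCover {Y : Type u} [TopologicalSpace Y] (𝒞 : Set (Set Y)) : Prop where
  locallyFinite : LocallyFinite (fun F : 𝒞 => (F : Set Y))
  isClosed : ∀ F ∈ 𝒞, IsClosed F
  cover : ⋃₀ 𝒞 = univ
  exists_open : ∃ G : Set Y → Set Y,
    (∀ F ∈ 𝒞, IsOpen (G F) ∧ F = closure (G F)) ∧ 𝒞.PairwiseDisjoint G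

/-- The order of a collection of subsets: the largest number of members with a common point. -/
noncomputable def coverOrder {Y : Type u} (𝒞 : Set (Set Y)) : ℕ∞ :=
  ⨆ y : Y, {F ∈ 𝒞 | y ∈ F}.encard

/-- `𝒱` refines `𝒰`. -/
def Refines {Y : Type u} (𝒱 𝒰 : Set (Set Y)) : Prop := ∀ V ∈ 𝒱, ∃ U ∈ 𝒰, V ⊆ U

/-- `Y` admits a fine directed system of canonical covers of order at most `n + 1`. -/
def CofinalDimLE (Y : Type u) [TopologicalSpace Y] (n : ℕ) : Prop :=
  ∃ (Ω : Type u) (_ : Preorder Ω) (𝓕 : Ω → Set (Set Y)),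
    Nonempty Ω ∧ (∀ α β : Ω, ∃ γ, α ≤ γ ∧ β ≤ γ) ∧
    (∀ α, IsCanonicalCover (𝓕 α)) ∧
    (∀ α β, α ≤ β → Refines (𝓕 β) (𝓕 α)) ∧
    (∀ 𝒰 : Set (Set Y), (∀ U ∈ 𝒰, IsOpen U) → ⋃₀ 𝒰 = univ → ∃ α, Refines (𝓕 α) 𝒰) ∧
    (∀ α, coverOrder (𝓕 α) ≤ n + 1)

open Classical in
/-- The cofinal dimension, with values in `{-1, 0, 1, …, ∞}`. -/
noncomputable def cofinalDim (Y : Type u) [TopologicalSpace Y] : WithTop ℤ :=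
  if IsEmpty Y then ((-1 : ℤ) : WithTop ℤ)
  else if ∃ n, CofinalDimLE Y n then (((sInf {n | CofinalDimLE Y n} : ℕ) : ℤ) : WithTop ℤ)
  else ⊤

/-! ## Higson functions -/

section Higson

open Filter Bornology

variable {X : Type u} [MetricSpace X]

/-! The trace of `A` on the corona is its set of limit points at infinity, and two sets are coarsely
near exactly when their traces meet (`metricCoarselyNear_iff`). One direction needs a Higson
function separating sets that are not near. In the other, Higson functions cannot tell apart the two
ends of pairs at bounded distance that run to infinity.

This turns coarse relations into topology. A coarse neighbourhood of `K` has a trace containing that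
of `K` in its interior, coarse inclusion is inclusion of traces, and traces of coarse neighbourhoods
give a neighbourhood basis (`exists_coarseNhd_of_mem_isOpen`).

The passage from `A` to the closure of the interior of its trace sends coarsely canonical covers to
canonical covers and coarse refinement to refinement. It does not raise the order: divergent sets
have no common trace point (`Divergent.exists_notMem_higsonTrace`). It preserves fineness, because
compactness of the corona lets `b`-covers refine every open cover. So a system witnessing a coarse
bound witnesses the same bound for the corona, over the same index set. -/

theorem mem_higsonFunctions_of_isBounded [ProperSpace X] (f : BoundedContinuousFunction X ℝ)
    (h : ∀ R > 0, ∀ ε > 0, ∃ K : Set X, IsBounded K ∧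
      ∀ x ∉ K, ∀ y, dist x y ≤ R → |f x - f y| < ε) : f ∈ higsonFunctions X := by
  intro R hR ε hε
  obtain ⟨K, hK, hf⟩ := h R hR ε hε
  exact ⟨closure K, Metric.isCompact_of_isClosed_isBounded isClosed_closure hK.closure,
    fun x hx y hxy => hf x (fun hxK => hx (subset_closure hxK)) y hxy⟩

/-- A tent function around `x₀`, as a Higson function. -/
theorem exists_higsonFunction_tent [ProperSpace X] (x₀ : X) :
    ∃ f : higsonFunctions X, f.1 x₀ = 1 ∧ ∀ x, 1 ≤ dist x x₀ → f.1 x = 0 := by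
  have hcont : Continuous fun x : X => max 0 (1 - dist x x₀) := by fun_prop
  refine ⟨⟨BoundedContinuousFunction.ofNormedAddCommGroup (fun x : X => max 0 (1 - dist x x₀))
    hcont 1 ?_, mem_higsonFunctions_of_isBounded _ ?_⟩, ?_, ?_⟩
  · intro x
    rw [Real.norm_of_nonneg (le_max_left _ _)]
    exact max_le zero_le_one (by linarith [dist_nonneg (x := x) (y := x₀)])
  · intro R hR ε hε
    -- Outside this ball, `x` and every point within `R` of it lie off the support of the tent.
    refine ⟨Metric.closedBall x₀ (R + 1), Metric.isBounded_closedBall, fun x hx y hxy => ?_⟩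
    rw [Metric.mem_closedBall, not_le] at hx
    have h1 := dist_triangle x y x₀
    simp only [BoundedContinuousFunction.coe_ofNormedAddCommGroup]
    rw [max_eq_left (by linarith), max_eq_left (by linarith)]
    simpa using hε
  · simp
  · intro x hx
    simpa using hx

/-! ### Separation of sets at infinity. -/

theorem not_metricCoarselyNear_iff {A B : Set X} : ¬ MetricCoarselyNear A B ↔
    ∀ ε : ℝ, ∃ D : Set X, IsBounded D ∧ ∀ a ∈ A \ D, ∀ b ∈ B \ D, ε ≤ dist a b := by
  simp only [MetricCoarselyNear]
  push Not
  rfl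

/-- A point of `B` outside the `ε`-thickening of `D` can be `ε`-close only to points of `A` outside
`D`, where separation applies. This yields the limit `1` of the separating function along `B`. -/
theorem eventually_le_infDist_of_not_near {A B : Set X} (hA : A.Nonempty)
    (h : ¬ MetricCoarselyNear A B) (ε : ℝ) :
    ∀ᶠ b in cobounded X ⊓ 𝓟 B, ε ≤ Metric.infDist b A := by
  obtain ⟨D, hD, hε⟩ := not_metricCoarselyNear_iff.1 h ε
  rw [eventually_inf_principal]
  filter_upwards [isBounded_def.1 (hD.cthickening (δ := ε)), isBounded_def.1 hD] with b hb hb' hbB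
  by_contra hc
  rw [not_le, Metric.infDist_lt_iff hA] at hc
  obtain ⟨a, haA, hab⟩ := hc
  by_cases haD : a ∈ D
  · exact hb (Metric.mem_cthickening_of_dist_le b a ε D haD hab.le)
  · have := hε a ⟨haA, haD⟩ b ⟨hbB, hb'⟩
    rw [dist_comm] at this
    linarith

/-- If both distances were small, almost nearest points of `A` and `B` would be close to each other
yet outside the exceptional set. The bound makes the denominator of the separating function large at
infinity. -/
theorem exists_isBounded_le_infDist_add {A B : Set X} (hA : A.Nonempty) (hB : B.Nonempty)
    (h : ¬ MetricCoarselyNear A B) (r : ℝ) :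
    ∃ K : Set X, IsBounded K ∧ ∀ x ∉ K, r ≤ Metric.infDist x A + Metric.infDist x B := by
  obtain ⟨D, hD, hr⟩ := not_metricCoarselyNear_iff.1 h r
  refine ⟨Metric.cthickening r D, hD.cthickening, fun x hx => ?_⟩
  by_contra hc
  rw [not_le] at hc
  have hA0 := Metric.infDist_nonneg (x := x) (s := A)
  have hB0 := Metric.infDist_nonneg (x := x) (s := B)
  set η := (r - (Metric.infDist x A + Metric.infDist x B)) / 2 with hη
  obtain ⟨a, ha, hxa⟩ := (Metric.infDist_lt_iff hA (r := Metric.infDist x A + η)).1 (by linarith)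
  obtain ⟨b, hb, hxb⟩ := (Metric.infDist_lt_iff hB (r := Metric.infDist x B + η)).1 (by linarith)
  have haD : a ∉ D := fun haD =>
    hx (Metric.mem_cthickening_of_dist_le x a r D haD (by linarith))
  have hbD : b ∉ D := fun hbD =>
    hx (Metric.mem_cthickening_of_dist_le x b r D hbD (by linarith))
  have := hr a ⟨ha, haD⟩ b ⟨hb, hbD⟩
  have := dist_triangle_left a b x
  linarith

/-- Sets that are not coarsely near are separated at infinity by a Higson function. -/
theorem exists_higsonFunction_separating [ProperSpace X] {A B : Set X} (hA : A.Nonempty)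
    (hB : B.Nonempty) (h : ¬ MetricCoarselyNear A B) :
    ∃ f : higsonFunctions X, (∀ a ∈ A, f.1 a = 0) ∧
      Tendsto f.1 (cobounded X ⊓ 𝓟 B) (𝓝 1) := by
  set p : X → ℝ := fun x => Metric.infDist x A with hp
  set q : X → ℝ := fun x => Metric.infDist x B with hq
  have hp0 : ∀ x, 0 ≤ p x := fun x => Metric.infDist_nonneg
  have hq0 : ∀ x, 0 ≤ q x := fun x => Metric.infDist_nonneg
  -- The summand `1` keeps the quotient continuous even where the closures of `A` and `B` meet; its
  -- price is that the value on `B` is `1` only in the limit.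
  have hs : ∀ x, 0 < 1 + p x + q x := fun x => by linarith [hp0 x, hq0 x]
  have hcont : Continuous fun x : X => p x / (1 + p x + q x) :=
    (Metric.continuous_infDist_pt A).div
      ((continuous_const.add (Metric.continuous_infDist_pt A)).add
        (Metric.continuous_infDist_pt B)) fun x => (hs x).ne'
  refine ⟨⟨BoundedContinuousFunction.ofNormedAddCommGroup _ hcont 1 ?_,
    mem_higsonFunctions_of_isBounded _ ?_⟩, ?_, ?_⟩
  · intro x
    rw [Real.norm_of_nonneg (div_nonneg (hp0 x) (hs x).le), div_le_one (hs x)]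
    linarith [hq0 x]
  · intro R hR ε hε
    obtain ⟨K, hK, hle⟩ := exists_isBounded_le_infDist_add hA hB h (3 * R / ε)
    refine ⟨K, hK, fun x hx y hxy => ?_⟩
    have hx' : 3 * R / ε ≤ p x + q x := hle x hx
    rw [div_le_iff₀ hε] at hx'
    simp only [BoundedContinuousFunction.coe_ofNormedAddCommGroup]
    have hpd : |p x - p y| ≤ R := by
      have h1 : p x ≤ p y + dist x y := Metric.infDist_le_infDist_add_dist
      have h2 : p y ≤ p x + dist y x := Metric.infDist_le_infDist_add_dist
      rw [dist_comm y x] at h2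
      rw [abs_le]
      constructor <;> linarith
    have hqd : |q x - q y| ≤ R := by
      have h1 : q x ≤ q y + dist x y := Metric.infDist_le_infDist_add_dist
      have h2 : q y ≤ q x + dist y x := Metric.infDist_le_infDist_add_dist
      rw [dist_comm y x] at h2
      rw [abs_le]
      constructor <;> linarith
    rw [div_sub_div _ _ (hs x).ne' (hs y).ne', abs_div, abs_of_pos (mul_pos (hs x) (hs y)),
      div_lt_iff₀ (mul_pos (hs x) (hs y))]
    -- With this splitting the factor `1 + p y + q y` cancels, so the variation is at most `R / (1 +
    -- p x + q x)` and only `x` has to be far out.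
    have e : p x * (1 + p y + q y) - (1 + p x + q x) * p y
        = (p x - p y) * (1 + q y) + p y * (q y - q x) := by ring
    rw [e]
    calc |(p x - p y) * (1 + q y) + p y * (q y - q x)|
        ≤ |p x - p y| * (1 + q y) + p y * |q x - q y| := by
          refine (abs_add_le _ _).trans (le_of_eq ?_)
          rw [abs_mul, abs_mul, abs_of_pos (by linarith [hq0 y] : 0 < 1 + q y),
            abs_of_nonneg (hp0 y), abs_sub_comm (q y)]
      _ ≤ R * (1 + q y) + p y * R :=
          add_le_add (mul_le_mul_of_nonneg_right hpd (by linarith [hq0 y]))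
            (mul_le_mul_of_nonneg_left hqd (hp0 y))
      _ = R * (1 + p y + q y) := by ring
      _ < ε * (1 + p x + q x) * (1 + p y + q y) :=
          mul_lt_mul_of_pos_right (by nlinarith) (hs y)
      _ = ε * ((1 + p x + q x) * (1 + p y + q y)) := by ring
  · intro a ha
    simp [hp, Metric.infDist_zero_of_mem ha]
  · simp only [BoundedContinuousFunction.coe_ofNormedAddCommGroup]
    have hpt : Tendsto p (cobounded X ⊓ 𝓟 B) atTop :=
      tendsto_atTop.2 fun r => eventually_le_infDist_of_not_near hA h r
    have hlim : Tendsto (fun x => 1 - (1 + p x)⁻¹) (cobounded X ⊓ 𝓟 B) (𝓝 (1 - 0)) :=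
      tendsto_const_nhds.sub (tendsto_inv_atTop_zero.comp (tendsto_atTop_add_const_left _ 1 hpt))
    rw [sub_zero] at hlim
    refine hlim.congr' ?_
    filter_upwards [mem_inf_of_right (mem_principal_self B)] with b hb
    have hqb : q b = 0 := Metric.infDist_zero_of_mem hb
    have : (1 + p b) ≠ 0 := by linarith [hp0 b]
    rw [hqb, add_zero]
    field_simp
    ring

/-! ## Traces on the Higson corona -/

theorem isCompact_higsonCompactification : IsCompact (higsonCompactification X) := by
  refine (isCompact_univ_pi fun f : higsonFunctions X =>
    isCompact_closedBall (0 : ℝ) ‖f.1‖).of_isClosed_subset isClosed_closure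
    (closure_minimal ?_ (isClosed_set_pi fun f _ => Metric.isClosed_closedBall))
  rintro _ ⟨x, rfl⟩ f -
  rw [mem_closedBall_zero_iff]
  exact f.1.norm_coe_le_norm x

theorem continuous_higsonEval : Continuous (higsonEval X) :=
  continuous_pi fun f => f.1.continuous

/-- The Higson corona consists of the cluster points of the evaluation map at infinity. -/
theorem mem_corona_iff [ProperSpace X] {z : higsonFunctions X → ℝ} :
    z ∈ higsonCompactification X \ range (higsonEval X) ↔
      MapClusterPt z (cobounded X) (higsonEval X) := by
  constructor
  · rintro ⟨hz, hz'⟩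
    rw [mapClusterPt_iff_frequently]
    intro s hs
    rw [frequently_iff]
    intro U hU
    have hc : IsCompact (closure Uᶜ) :=
      Metric.isCompact_of_isClosed_isBounded isClosed_closure
        (IsBounded.closure (isBounded_def.2 (by rwa [compl_compl])))
    -- The image of a compact set is closed and misses `z`, so points of the image near `z` come
    -- from arbitrarily far out.
    have hopen : (higsonEval X '' closure Uᶜ)ᶜ ∈ 𝓝 z :=
      (hc.image continuous_higsonEval).isClosed.isOpen_compl.mem_nhds
        fun h => hz' (image_subset_range _ _ h)
    obtain ⟨_, ⟨hw, hws⟩, x, rfl⟩ := mem_closure_iff_nhds.1 hz _ (inter_mem hopen hs)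
    refine ⟨x, by_contra fun hx => hw ⟨x, subset_closure hx, rfl⟩, hws⟩
  · intro hz
    refine ⟨isClosed_closure.mem_of_mapClusterPt hz
      (Eventually.of_forall fun x => subset_closure (mem_range_self x)), ?_⟩
    rintro ⟨x₀, rfl⟩
    obtain ⟨f, hf1, hf0⟩ := exists_higsonFunction_tent x₀
    have h1 := hz.continuousAt_comp (continuous_apply f).continuousAt
    have h2 : ∀ᶠ x in cobounded X, f.1 x ∈ ({0} : Set ℝ) := by
      filter_upwards [isBounded_def.1 (Metric.isBounded_ball (x := x₀) (r := 1))] with x hx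
      refine hf0 x ?_
      simpa using hx
    have h3 : f.1 x₀ ∈ ({0} : Set ℝ) := isClosed_singleton.mem_of_mapClusterPt h1 h2
    rw [hf1] at h3
    exact one_ne_zero h3

instance [ProperSpace X] : CompactSpace (HigsonCorona X) := by
  rw [← isCompact_iff_compactSpace]
  have : higsonCompactification X \ range (higsonEval X) =
      {z | ClusterPt z (map (higsonEval X) (cobounded X))} := by
    ext z
    exact mem_corona_iff
  refine isCompact_higsonCompactification.of_isClosed_subset ?_ sdiff_subset
  rw [this]
  exact isClosed_setOfPred_clusterPt

/-- The trace of a subset of `X` on the Higson corona. -/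
def higsonTrace (A : Set X) : Set (HigsonCorona X) :=
  {y | MapClusterPt y.1 (cobounded X ⊓ 𝓟 A) (higsonEval X)}

theorem higsonTrace_mono {A B : Set X} (h : A ⊆ B) : higsonTrace A ⊆ higsonTrace B :=
  fun _ hy => MapClusterPt.mono hy (inf_le_inf_left _ (principal_mono.2 h))

theorem higsonTrace_union (A B : Set X) :
    higsonTrace (A ∪ B) = higsonTrace A ∪ higsonTrace B := by
  ext y
  simp only [higsonTrace, mapClusterPt_def, mem_ofPred_eq, mem_union]
  rw [← sup_principal, inf_sup_left, Filter.map_sup, clusterPt_sup]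

theorem higsonTrace_univ [ProperSpace X] : higsonTrace (univ : Set X) = univ := by
  ext y
  simpa [higsonTrace] using mem_corona_iff.1 y.2

theorem mem_higsonTrace_of_notMem_compl [ProperSpace X] {A : Set X} {y : HigsonCorona X}
    (h : y ∉ higsonTrace Aᶜ) : y ∈ higsonTrace A := by
  have : y ∈ higsonTrace (A ∪ Aᶜ) := by rw [union_compl_self, higsonTrace_univ]; trivial
  rw [higsonTrace_union] at this
  exact this.resolve_right h

theorem isClosed_higsonTrace (A : Set X) : IsClosed (higsonTrace A) :=
  isClosed_setOfPred_clusterPt.preimage continuous_subtype_val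

theorem higsonTrace_eq_empty_of_isBounded {A : Set X} (h : IsBounded A) : higsonTrace A = ∅ := by
  rw [eq_empty_iff_forall_notMem]
  intro y hy
  have hb : cobounded X ⊓ 𝓟 A = ⊥ := (disjoint_principal_right.2 (isBounded_def.1 h)).eq_bot
  simp only [higsonTrace, mem_ofPred_eq, hb] at hy
  simp only [mapClusterPt_def, ClusterPt, Filter.map_bot, inf_bot_eq] at hy
  exact hy.ne rfl

theorem neBot_cobounded_inf_principal {A : Set X} (h : ¬ IsBounded A) :
    (cobounded X ⊓ 𝓟 A).NeBot := by
  rw [neBot_iff, Ne, ← disjoint_iff, disjoint_principal_right]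
  exact fun hc => h (isBounded_def.2 hc)

theorem exists_corona_mapClusterPt [ProperSpace X] {F : Filter X} [F.NeBot]
    (h : F ≤ cobounded X) : ∃ y : HigsonCorona X, MapClusterPt y.1 F (higsonEval X) := by
  obtain ⟨z, -, hz⟩ := isCompact_higsonCompactification.exists_mapClusterPt (f := F)
    (u := higsonEval X) (tendsto_principal.2 <|
      Eventually.of_forall fun x => subset_closure (mem_range_self x))
  exact ⟨⟨z, mem_corona_iff.2 (hz.mono h)⟩, hz⟩

theorem higsonTrace_nonempty_iff [ProperSpace X] {A : Set X} :
    (higsonTrace A).Nonempty ↔ ¬ IsBounded A := by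
  refine ⟨fun h hA => h.ne_empty (higsonTrace_eq_empty_of_isBounded hA), fun h => ?_⟩
  have := neBot_cobounded_inf_principal h
  exact exists_corona_mapClusterPt (F := cobounded X ⊓ 𝓟 A) inf_le_left

/-- The coordinate of a separating Higson function is `0` on one trace and `1` on the other. -/
theorem disjoint_higsonTrace_of_not_near [ProperSpace X] {A B : Set X}
    (h : ¬ MetricCoarselyNear A B) : Disjoint (higsonTrace A) (higsonTrace B) := by
  rw [Set.disjoint_left]
  intro y hyA hyB
  have hA : A.Nonempty := by
    rw [nonempty_iff_ne_empty]
    rintro rfl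
    rwa [higsonTrace_eq_empty_of_isBounded isBounded_empty] at hyA
  have hB : B.Nonempty := by
    rw [nonempty_iff_ne_empty]
    rintro rfl
    rwa [higsonTrace_eq_empty_of_isBounded isBounded_empty] at hyB
  obtain ⟨f, hf0, hf1⟩ := exists_higsonFunction_separating hA hB h
  have h0 : y.1 f ∈ ({0} : Set ℝ) := by
    have := MapClusterPt.continuousAt_comp (continuous_apply f).continuousAt hyA
    refine isClosed_singleton.mem_of_mapClusterPt this ?_
    filter_upwards [mem_inf_of_right (mem_principal_self A)] with a ha using hf0 a ha
  have h1 : y.1 f = 1 := by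
    have := MapClusterPt.continuousAt_comp (continuous_apply f).continuousAt hyB
    have h2 : ClusterPt (y.1 f) (𝓝 1) := ClusterPt.mono this hf1
    exact eq_of_nhds_neBot h2
  rw [mem_singleton_iff, h1] at h0
  exact one_ne_zero h0

/-- The `ε`-close pairs in `A × B` form a filter going to infinity. Every Higson function has the
same limits along both projections, so a limit point of the first is one of the second. -/
theorem higsonTrace_inter_nonempty_of_near [ProperSpace X] {A B : Set X}
    (h : MetricCoarselyNear A B) : (higsonTrace A ∩ higsonTrace B).Nonempty := by
  obtain ⟨ε, h⟩ := h
  set F : Filter (X × X) := (cobounded X ×ˢ cobounded X) ⊓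
    𝓟 {p | p.1 ∈ A ∧ p.2 ∈ B ∧ dist p.1 p.2 < ε} with hF
  have hne : F.NeBot := by
    rw [hF, inf_principal_neBot_iff]
    intro U hU
    obtain ⟨V, hV, W, hW, hVW⟩ := mem_prod_iff.1 hU
    obtain ⟨a, ha, b, hb, hab⟩ := h (V ∩ W)ᶜ (isBounded_def.2 (by
      rw [compl_compl]; exact inter_mem hV hW))
    have ha' : a ∈ V ∩ W := by simpa using ha.2
    have hb' : b ∈ V ∩ W := by simpa using hb.2
    exact ⟨(a, b), hVW ⟨ha'.1, hb'.2⟩, ha.1, hb.1, hab⟩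
  have hFprod : F ≤ cobounded X ×ˢ cobounded X := inf_le_left
  have hmem : ∀ᶠ p in F, p.1 ∈ A ∧ p.2 ∈ B ∧ dist p.1 p.2 < ε :=
    mem_inf_of_right (mem_principal_self _)
  have hfst : Tendsto Prod.fst F (cobounded X ⊓ 𝓟 A) := tendsto_inf.2
    ⟨tendsto_fst.mono_left hFprod, tendsto_principal.2 (hmem.mono fun p hp => hp.1)⟩
  have hsnd : Tendsto Prod.snd F (cobounded X ⊓ 𝓟 B) := tendsto_inf.2
    ⟨tendsto_snd.mono_left hFprod, tendsto_principal.2 (hmem.mono fun p hp => hp.2.1)⟩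
  obtain ⟨y, hy⟩ := exists_corona_mapClusterPt (F := map Prod.fst F)
    (hfst.mono_right inf_le_left)
  have hy1 : MapClusterPt y.1 F (higsonEval X ∘ Prod.fst) := hy
  -- Along an ultrafilter clustering becomes convergence, which can be combined with differences
  -- tending to `0`.
  obtain ⟨G, hG, hGy⟩ := mapClusterPt_iff_ultrafilter.1 hy1
  refine ⟨y, MapClusterPt.of_comp hfst hy1, MapClusterPt.of_comp hsnd ?_⟩
  refine mapClusterPt_iff_ultrafilter.2 ⟨G, hG, ?_⟩
  rw [tendsto_pi_nhds] at hGy ⊢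
  intro f
  have hdiff : Tendsto (fun p : X × X => f.1 p.1 - f.1 p.2) F (𝓝 0) := by
    rw [Metric.tendsto_nhds]
    intro η hη
    -- Higson functions are tested at positive radii, while `ε` is an arbitrary real.
    obtain ⟨K, hK, hfK⟩ := f.2 (max ε 1) (lt_max_of_lt_right one_pos) η hη
    have hKb : Kᶜ ∈ cobounded X := isBounded_def.1 hK.isBounded
    filter_upwards [hmem, (hfst.mono_right inf_le_left).eventually hKb] with p hp hpK
    rw [Real.dist_eq, sub_zero]
    exact hfK p.1 hpK p.2 (hp.2.2.le.trans (le_max_left _ _))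
  have := (hGy f).sub (hdiff.mono_left hG)
  simpa [higsonEval] using this

/-! ### Coarse relations read off from traces. -/

theorem metricCoarselyNear_iff [ProperSpace X] {A B : Set X} :
    MetricCoarselyNear A B ↔ (higsonTrace A ∩ higsonTrace B).Nonempty :=
  ⟨higsonTrace_inter_nonempty_of_near, fun h => by_contra fun hn =>
    h.ne_empty (disjoint_higsonTrace_of_not_near hn).inter_eq⟩

theorem higsonTrace_subset_of_preimage {A : Set X} {C : Set (higsonFunctions X → ℝ)}
    (hC : IsClosed C) (h : ∀ a ∈ A, higsonEval X a ∈ C) :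
    higsonTrace A ⊆ Subtype.val ⁻¹' C := fun _ hy =>
  hC.mem_of_mapClusterPt hy (mem_inf_of_right (mem_principal.2 h))

/-- Traces of coarse neighbourhoods form a neighbourhood basis of the Higson corona. -/
theorem exists_coarseNhd_of_mem_isOpen [ProperSpace X] {V : Set (HigsonCorona X)} (hV : IsOpen V)
    {y : HigsonCorona X} (hy : y ∈ V) :
    ∃ K D : Set X, (metricCoarseProximity X).CoarseNhd K D ∧ y ∉ higsonTrace Kᶜ ∧
      higsonTrace D ⊆ V ∧ K ⊆ D := by
  obtain ⟨W, hW, rfl⟩ := isOpen_induced_iff.1 hV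
  -- Two nested closed neighbourhoods are used: the preimages of `C'` and of the complement of
  -- `interior C` have disjoint traces, so they are not near.
  obtain ⟨C, ⟨hCn, hCc⟩, hCW⟩ := (closed_nhds_basis y.1).mem_iff.1 (hW.mem_nhds hy)
  obtain ⟨C', ⟨hCn', hCc'⟩, hCC'⟩ :=
    (closed_nhds_basis y.1).mem_iff.1 (interior_mem_nhds.2 hCn)
  refine ⟨higsonEval X ⁻¹' C', higsonEval X ⁻¹' (interior C), ?_, ?_, ?_,
    preimage_mono hCC'⟩
  · intro hn
    obtain ⟨z, hz1, hz2⟩ := higsonTrace_inter_nonempty_of_near hn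
    exact higsonTrace_subset_of_preimage (isOpen_interior.isClosed_compl) (fun a ha => ha) hz2
      (hCC' (higsonTrace_subset_of_preimage hCc' (fun a ha => ha) hz1))
  · intro hc
    have := higsonTrace_subset_of_preimage (A := (higsonEval X ⁻¹' C')ᶜ)
      (C := (interior C')ᶜ) isOpen_interior.isClosed_compl
      (fun a ha hi => ha (show higsonEval X a ∈ C' from interior_subset hi)) hc
    exact this (mem_interior_iff_mem_nhds.2 hCn')
  · exact (higsonTrace_subset_of_preimage hCc fun a ha => interior_subset ha).trans
      (preimage_mono hCW)

theorem higsonTrace_subset_interior_of_coarseNhd [ProperSpace X] {K D : Set X}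
    (h : (metricCoarseProximity X).CoarseNhd K D) : higsonTrace K ⊆ interior (higsonTrace D) :=
  (disjoint_higsonTrace_of_not_near h).subset_compl_right.trans <|
    interior_maximal (fun _ hy => mem_higsonTrace_of_notMem_compl hy)
      (isClosed_higsonTrace Dᶜ).isOpen_compl

/-- A point in the trace of `A` but not of `C` has a basic neighbourhood missing the trace of `C`;
the set behind it is near `A` and not near `C`. -/
theorem coarseSubset_iff_higsonTrace_subset [ProperSpace X] {A C : Set X} :
    (metricCoarseProximity X).CoarseSubset A C ↔ higsonTrace A ⊆ higsonTrace C := by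
  constructor
  · intro h y hyA
    by_contra hyC
    obtain ⟨K, D, hKD, hyK, hDC, -⟩ :=
      exists_coarseNhd_of_mem_isOpen (isClosed_higsonTrace C).isOpen_compl hyC
    have hyD : y ∈ higsonTrace D := interior_subset
      (higsonTrace_subset_interior_of_coarseNhd hKD (mem_higsonTrace_of_notMem_compl hyK))
    obtain ⟨z, hzC, hzD⟩ :=
      higsonTrace_inter_nonempty_of_near (h D (metricCoarselyNear_iff.2 ⟨y, hyA, hyD⟩))
    exact hDC hzD hzC
  · intro h D hD
    obtain ⟨z, hzA, hzD⟩ := higsonTrace_inter_nonempty_of_near hD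
    exact metricCoarselyNear_iff.2 ⟨z, h hzA, hzD⟩

theorem higsonTrace_subset_interior_of_weakCoarseNhd [ProperSpace X] {K A : Set X}
    (h : (metricCoarseProximity X).WeakCoarseNhd K A) :
    higsonTrace K ⊆ interior (higsonTrace A) := by
  obtain ⟨D, hKD, hDA⟩ := h
  exact (higsonTrace_subset_interior_of_coarseNhd hKD).trans
    (interior_mono (coarseSubset_iff_higsonTrace_subset.1 hDA))

end Higson

/-! ## Clusters and divergence -/

section Divergence

open Filter Bornology

namespace Proximity

variable {X : Type u} (δ : Proximity X)

/-- The cluster of all sets near every member of an ultrafilter. -/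
def ultrafilterCluster (p : Ultrafilter X) : δ.Cluster where
  sets := {A | ∀ B ∈ p, δ.near A B}
  nonempty := ⟨univ, fun B hB => δ.of_inter_nonempty _ _ (by simpa using p.nonempty_of_mem hB)⟩
  near_of_mem := by
    intro A hA B hB
    by_contra h
    obtain ⟨E, hE, hE'⟩ := δ.strong A B h
    rcases p.mem_or_compl_mem E with hp | hp
    · exact hE' (δ.symm _ _ (hB E hp))
    · exact hE (hA _ hp)
  mem_or_mem := by
    intro A B h
    by_contra hc
    simp only [mem_ofPred_eq, not_or, not_forall] at hc
    obtain ⟨⟨C, hC, hAC⟩, D, hD, hBD⟩ := hc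
    rcases (δ.near_union_iff _ _ _).1 (δ.symm _ _ (h (C ∩ D) (inter_mem hC hD))) with h | h
    · exact hAC (δ.near_mono_right (δ.symm _ _ h) inter_subset_left)
    · exact hBD (δ.near_mono_right (δ.symm _ _ h) inter_subset_right)
  mem_of_near := by
    intro C h B hB
    exact h B fun D hD => δ.of_inter_nonempty _ _ (p.nonempty_of_mem (inter_mem hB hD))

/-- `D` absorbs this set, so it is near every member of a cluster adherent to it and belongs to that
cluster by maximality. -/
theorem isClosed_setOf_mem_cluster (D : Set X) : IsClosed {σ : δ.Cluster | D ∈ σ.sets} := by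
  rw [← isOpen_compl_iff]
  change {σ : δ.Cluster | D ∈ σ.sets}ᶜᶜ ∈ {A | ∀ x, δ.smirnov.near {x} A → x ∈ A}
  rw [compl_compl]
  intro σ hσ
  refine σ.mem_of_near D fun A hA => δ.symm _ _ ?_
  exact hσ A D (fun τ hτ => by rw [mem_singleton_iff] at hτ; exact hτ ▸ hA) fun τ hτ => hτ

theorem mem_of_mem_closure_pointCluster {D : Set X} {σ : δ.Cluster}
    (h : σ ∈ closure (δ.pointCluster '' D)) : D ∈ σ.sets := by
  refine closure_minimal ?_ (δ.isClosed_setOf_mem_cluster D) h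
  rintro _ ⟨x, hx, rfl⟩
  exact δ.of_inter_nonempty _ _ ⟨x, rfl, hx⟩

end Proximity

variable {X : Type u} [MetricSpace X] [ProperSpace X]

/-- No homeomorphism between the Smirnov boundary and the corona is needed. An ultrafilter at
infinity converging to `y` defines a boundary cluster, which lies in the trace of some `D A`. This
forces `y` into the trace of `D A`, and that trace is disjoint from the trace of `A`. -/
theorem CoarseProximity.Divergent.exists_notMem_higsonTrace {S : Set (Set X)}
    (h : (metricCoarseProximity X).Divergent S) (y : HigsonCorona X) :
    ∃ A ∈ S, y ∉ higsonTrace A := by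
  obtain ⟨-, D, hD, hcov⟩ := h
  by_contra! hy
  obtain ⟨p, hp, hpy⟩ := mapClusterPt_iff_ultrafilter.1 (mem_corona_iff.1 y.2)
  set δ := (metricCoarseProximity X).discreteExtension
  have hσ : ∀ B ∈ (δ.ultrafilterCluster p).sets, ¬ IsBounded B := by
    intro B hB hb
    rcases hB Bᶜ (hp (isBounded_def.1 hb)) with h | h
    · simp at h
    · exact ((metricCoarseProximity X).unbounded_of_near _ _ h).1 hb
  have hmem : (⟨δ.ultrafilterCluster p, hσ⟩ : (metricCoarseProximity X).Boundary) ∈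
      ⋃ A ∈ S, (metricCoarseProximity X).trace (D A) := hcov ▸ mem_univ _
  obtain ⟨A, hA, hσA⟩ := mem_iUnion₂.1 hmem
  have hDA : D A ∈ (δ.ultrafilterCluster p).sets := δ.mem_of_mem_closure_pointCluster hσA
  have hnear : ¬ MetricCoarselyNear (D A) A := by
    have := hD A hA
    rwa [CoarseProximity.CoarseNhd, compl_compl] at this
  have hyD : y ∈ (higsonTrace (D A))ᶜ := fun hyD =>
    Set.disjoint_left.1 (disjoint_higsonTrace_of_not_near hnear) hyD (hy A hA)
  have hpmem : ∀ B ∈ p, y ∈ higsonTrace B := fun B hB =>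
    mapClusterPt_iff_ultrafilter.2 ⟨p, le_inf hp (le_principal_iff.2 hB), hpy⟩
  obtain ⟨K, E, hKE, hyK, hE, -⟩ :=
    exists_coarseNhd_of_mem_isOpen (isClosed_higsonTrace (D A)).isOpen_compl hyD
  -- Removing `D A` excludes the alternative of a common point in the discrete extension, leaving
  -- coarse nearness.
  have hKp : K \ D A ∈ p := inter_mem
    (by_contra fun hK => hyK (hpmem _ (Ultrafilter.compl_mem_iff_notMem.2 hK)))
    (Ultrafilter.compl_mem_iff_notMem.2 fun hK => hyD (hpmem _ hK))
  rcases hDA _ hKp with ⟨x, hx, hx'⟩ | hn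
  · exact hx'.2 hx
  · obtain ⟨z, hzD, hzK⟩ := higsonTrace_inter_nonempty_of_near hn
    exact hE (interior_subset (higsonTrace_subset_interior_of_coarseNhd hKE
      (higsonTrace_mono sdiff_subset hzK))) hzD

end Divergence

/-! ## From coarsely canonical covers to canonical covers of the corona -/

section Covers

open Filter Bornology

theorem CoarseProximity.near_biUnion_finset {X ι : Type*} [Bornology X] (P : CoarseProximity X)
    (t : Finset ι) (K : ι → Set X) (E : Set X) (h : P.near (⋃ i ∈ t, K i) E) :
    ∃ i ∈ t, P.near (K i) E := by
  classical
  induction t using Finset.induction_on with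
  | empty =>
    simp only [Finset.notMem_empty, iUnion_of_empty, iUnion_empty] at h
    exact ((P.unbounded_of_near _ _ h).1 isBounded_empty).elim
  | insert i t _ ih =>
    rw [Finset.set_biUnion_insert, P.union_near_iff] at h
    rcases h with h | h
    · exact ⟨i, Finset.mem_insert_self i t, h⟩
    · obtain ⟨j, hj, hn⟩ := ih h
      exact ⟨j, Finset.mem_insert_of_mem hj, hn⟩

variable {X : Type u} [MetricSpace X]

/-- The closed subsets of the Higson corona that a cover of `X` by coarse sets induces: the regular
closed parts of the traces of its unbounded members. -/
def coronaCover (𝒜 : Set (Set X)) : Set (Set (HigsonCorona X)) :=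
  (fun A => closure (interior (higsonTrace A))) '' {A ∈ 𝒜 | ¬ IsBounded A}

theorem closure_interior_higsonTrace_subset (A : Set X) :
    closure (interior (higsonTrace A)) ⊆ higsonTrace A :=
  (isClosed_higsonTrace A).closure_interior_subset

/-- Bounded sets have empty trace, so the bounded error disappears. As nothing is asked of the two
collections, this also applies when the coarser one is a `b`-cover. -/
theorem refines_coronaCover {𝒜 ℬ : Set (Set X)} (h : CoarselyRefines ℬ 𝒜) :
    Refines (coronaCover ℬ) (coronaCover 𝒜) := by
  rintro _ ⟨C, ⟨hC, hCb⟩, rfl⟩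
  obtain ⟨A, hA, hAb, B, hB, hCA⟩ := h C hC hCb
  refine ⟨_, ⟨A, ⟨hA, hAb⟩, rfl⟩, closure_mono (interior_mono ?_)⟩
  have := higsonTrace_mono (sdiff_subset_iff.1 hCA)
  rwa [higsonTrace_union, higsonTrace_eq_empty_of_isBounded hB, empty_union] at this

variable [ProperSpace X]

theorem isCanonicalCover_coronaCover {𝒜 : Set (Set X)}
    (h : (metricCoarseProximity X).IsCoarselyCanonicalCover 𝒜) :
    IsCanonicalCover (coronaCover 𝒜) := by
  have hfin : (coronaCover 𝒜).Finite := (h.finite.subset (sep_subset _ _)).image _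
  have hclosed : ∀ F ∈ coronaCover 𝒜, IsClosed F := by
    rintro _ ⟨A, -, rfl⟩
    exact isClosed_closure
  refine ⟨?_, hclosed, ?_, fun F => interior F, ?_, ?_⟩
  · have := hfin.to_subtype
    exact locallyFinite_of_finite _
  -- A missed point has a basic neighbourhood off the finite closed union; the `dense` axiom puts
  -- inside it a nonempty trace lying in the interior of the trace of a member.
  · by_contra hne
    obtain ⟨y, hy⟩ := (ne_univ_iff_exists_notMem _).1 hne
    obtain ⟨K, D, hKD, hyK, hD, -⟩ := exists_coarseNhd_of_mem_isOpen
      (sUnion_eq_biUnion ▸ hfin.isClosed_biUnion hclosed).isOpen_compl hy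
    have hK : ¬ IsBounded K :=
      higsonTrace_nonempty_iff.1 ⟨y, mem_higsonTrace_of_notMem_compl hyK⟩
    obtain ⟨C, A, hA, hC, hCD, hCA⟩ := h.dense K D hK hKD
    obtain ⟨z, hz⟩ := higsonTrace_nonempty_iff.2 hC
    have hzA := higsonTrace_subset_interior_of_weakCoarseNhd hCA hz
    exact hD (interior_subset (higsonTrace_subset_interior_of_coarseNhd hCD hz))
      ⟨_, ⟨A, ⟨hA, higsonTrace_nonempty_iff.1 ⟨z, interior_subset hzA⟩⟩, rfl⟩, subset_closure hzA⟩
  · rintro _ ⟨A, -, rfl⟩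
    refine ⟨isOpen_interior, ?_⟩
    refine (closure_mono (interior_maximal subset_closure isOpen_interior)).antisymm ?_
    exact isClosed_closure.closure_interior_subset
  -- A common interior point would give an unbounded `K` with both `A` and `A'` as weak coarse
  -- neighbourhoods, against `not_common`.
  · rintro _ ⟨A, ⟨hA, -⟩, rfl⟩ _ ⟨A', ⟨hA', -⟩, rfl⟩ hne
    rw [Function.onFun, Set.disjoint_left]
    intro y hy hy'
    obtain ⟨K, D, hKD, hyK, hD, -⟩ := exists_coarseNhd_of_mem_isOpen
      (isOpen_interior.inter isOpen_interior) ⟨hy, hy'⟩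
    have hDA : (metricCoarseProximity X).CoarseSubset D A :=
      coarseSubset_iff_higsonTrace_subset.2 fun z hz =>
        closure_interior_higsonTrace_subset A (interior_subset (hD hz).1)
    have hDA' : (metricCoarseProximity X).CoarseSubset D A' :=
      coarseSubset_iff_higsonTrace_subset.2 fun z hz =>
        closure_interior_higsonTrace_subset A' (interior_subset (hD hz).2)
    exact h.not_common A hA A' hA' (fun e => hne (by rw [e]))
      ⟨K, higsonTrace_nonempty_iff.1 ⟨y, mem_higsonTrace_of_notMem_compl hyK⟩,
        ⟨D, hKD, hDA⟩, ⟨D, hKD, hDA'⟩⟩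

theorem coverOrder_coronaCover_le {𝒜 : Set (Set X)} (hfin : 𝒜.Finite) :
    coverOrder (coronaCover 𝒜) ≤ (metricCoarseProximity X).coarseOrder 𝒜 := by
  set m := (metricCoarseProximity X).coarseOrder 𝒜 with hm
  have hmem : ∀ S ⊆ 𝒜, S.encard = m + 1 → (metricCoarseProximity X).Divergent S := by
    -- The infimum is attained because the set is nonempty: for `𝒜.ncard` the condition is vacuous.
    refine Nat.sInf_mem (s := {m : ℕ | ∀ S ⊆ 𝒜, S.encard = m + 1 →
      (metricCoarseProximity X).Divergent S}) ⟨𝒜.ncard, fun S hS hcard => ?_⟩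
    have hle := encard_le_encard hS
    rw [hcard, ← hfin.cast_ncard_eq] at hle
    exact absurd hle (by norm_cast; lia)
  refine iSup_le fun y => ?_
  by_contra! hlt
  obtain ⟨T, hT, hTcard⟩ := exists_subset_encard_eq (Order.add_one_le_of_lt hlt)
  have hsurj : SurjOn (fun A => closure (interior (higsonTrace A)))
      {A ∈ 𝒜 | y ∈ higsonTrace A} T := by
    intro F hF
    obtain ⟨⟨A, ⟨hA, -⟩, rfl⟩, hy⟩ := hT hF
    exact ⟨A, ⟨hA, closure_interior_higsonTrace_subset A hy⟩, rfl⟩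
  -- Different members of `𝒜` may induce the same closed set; choosing one preimage for each keeps
  -- the count at exactly `m + 1`.
  obtain ⟨S, hS, hbij⟩ := hsurj.exists_bijOn_subset
  have hScard : S.encard = m + 1 := by
    rw [← hTcard, ← hbij.image_eq, hbij.injOn.encard_image]
  obtain ⟨A, hA, hyA⟩ := (hmem S (hS.trans (sep_subset _ _)) hScard).exists_notMem_higsonTrace y
  exact hyA (hS hA).2

/-- Every open cover of the Higson corona is refined by the traces of a coarse cover. -/
theorem exists_isBCover_higsonTrace_subset {𝒰 : Set (Set (HigsonCorona X))}
    (ho : ∀ U ∈ 𝒰, IsOpen U) (hc : ⋃₀ 𝒰 = univ) :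
    ∃ 𝒱 : Set (Set X), (metricCoarseProximity X).IsBCover 𝒱 ∧
      ∀ D ∈ 𝒱, ¬ IsBounded D → ∃ U ∈ 𝒰, higsonTrace D ⊆ U := by
  classical
  have hex : ∀ y : HigsonCorona X, ∃ U ∈ 𝒰, ∃ K D : Set X,
      (metricCoarseProximity X).CoarseNhd K D ∧ y ∉ higsonTrace Kᶜ ∧ higsonTrace D ⊆ U ∧ K ⊆ D := by
    intro y
    obtain ⟨U, hU, hy⟩ := mem_sUnion.1 (hc ▸ mem_univ y)
    exact ⟨U, hU, exists_coarseNhd_of_mem_isOpen (ho U hU) hy⟩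
  choose U hU K D hKD hyK hDU hsub using hex
  obtain ⟨t, ht⟩ := isCompact_univ.elim_finite_subcover (fun y => (higsonTrace (K y)ᶜ)ᶜ)
    (fun y => (isClosed_higsonTrace _).isOpen_compl)
    (fun y _ => mem_iUnion.2 ⟨y, hyK y⟩)
  -- The part of `X` missed by the finitely many `K y` has empty trace, hence serves as the bounded
  -- member.
  set B : Set X := (⋃ y ∈ t, K y)ᶜ
  have hB : IsBounded B := by
    by_contra hB
    obtain ⟨z, hz⟩ := higsonTrace_nonempty_iff.2 hB
    obtain ⟨y, hyt, hy⟩ := mem_iUnion₂.1 (ht (mem_univ z))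
    exact hy (higsonTrace_mono (compl_subset_compl.2 (subset_biUnion_of_mem hyt)) hz)
  have hD : ∀ y, ¬ IsBounded (D y) := fun y => higsonTrace_nonempty_iff.1
    ⟨y, interior_subset (higsonTrace_subset_interior_of_coarseNhd (hKD y)
      (mem_higsonTrace_of_notMem_compl (hyK y)))⟩
  -- Shrinkings are indexed by sets, and several `y` may share one `D y`, so the shrinking of `A`
  -- collects all `K y` with `D y = A`. The bounded member shrinks to itself, since a bounded set is
  -- near nothing.
  refine ⟨insert B (D '' t), ⟨(t.finite_toSet.image D).insert B, ⟨B, ⟨mem_insert _ _, hB⟩, ?_⟩, ?_,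
    fun A => if IsBounded A then A else ⋃ y ∈ t.filter (D · = A), K y, ?_, ?_⟩, ?_⟩
  · rintro _ ⟨rfl | ⟨y, -, rfl⟩, hb⟩
    · rfl
    · exact (hD y hb).elim
  · refine eq_univ_of_forall fun x => ?_
    by_cases hx : x ∈ B
    · exact ⟨B, mem_insert _ _, hx⟩
    · obtain ⟨y, hy, hxy⟩ := mem_iUnion₂.1 (notMem_compl_iff.1 hx)
      exact ⟨D y, mem_insert_of_mem _ ⟨y, hy, rfl⟩, hsub y hxy⟩
  · refine eq_univ_of_forall fun x => ?_
    by_cases hx : x ∈ B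
    · exact mem_iUnion₂.2 ⟨B, mem_insert _ _, by simpa only [if_pos hB] using hx⟩
    · obtain ⟨y, hy, hxy⟩ := mem_iUnion₂.1 (notMem_compl_iff.1 hx)
      refine mem_iUnion₂.2 ⟨D y, mem_insert_of_mem _ ⟨y, hy, rfl⟩, ?_⟩
      simp only [if_neg (hD y)]
      exact mem_iUnion₂.2 ⟨y, Finset.mem_filter.2 ⟨hy, rfl⟩, hxy⟩
  · intro A _ hn
    dsimp only at hn
    split_ifs at hn with hA
    · exact ((metricCoarseProximity X).unbounded_of_near _ _ hn).1 hA
    · obtain ⟨y, hy, hn⟩ := (metricCoarseProximity X).near_biUnion_finset _ _ _ hn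
      obtain rfl := (Finset.mem_filter.1 hy).2
      exact hKD y hn
  · rintro _ (rfl | ⟨y, -, rfl⟩) hb
    · exact (hb hB).elim
    · exact ⟨U y, hU y, hDU y⟩

theorem CoarseProximity.CoarseCofinalDimLE.cofinalDimLE {n : ℕ}
    (h : (metricCoarseProximity X).CoarseCofinalDimLE n) : CofinalDimLE (HigsonCorona X) n := by
  obtain ⟨Ω, hΩ, 𝓕, hne, hdir, hcan, href, hfine, hord⟩ := h
  refine ⟨Ω, hΩ, fun α => coronaCover (𝓕 α), hne, hdir,
    fun α => isCanonicalCover_coronaCover (hcan α),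
    fun α β hαβ => refines_coronaCover (href α β hαβ), fun 𝒰 ho hc => ?_, fun α => ?_⟩
  · obtain ⟨𝒱, h𝒱, hsub⟩ := exists_isBCover_higsonTrace_subset ho hc
    obtain ⟨α, hα⟩ := hfine 𝒱 h𝒱
    refine ⟨α, fun F hF => ?_⟩
    obtain ⟨_, ⟨D, ⟨hD, hDb⟩, rfl⟩, hFD⟩ := refines_coronaCover hα F hF
    obtain ⟨U, hU, hDU⟩ := hsub D hD hDb
    exact ⟨U, hU, hFD.trans ((closure_interior_higsonTrace_subset D).trans hDU)⟩
  · exact (coverOrder_coronaCover_le (hcan α).finite).trans (by exact_mod_cast hord α)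

theorem isEmpty_higsonCorona (h : IsBounded (univ : Set X)) : IsEmpty (HigsonCorona X) := by
  rw [← Set.univ_eq_empty_iff, ← higsonTrace_univ]
  exact higsonTrace_eq_empty_of_isBounded h

end Covers

theorem mainTheorem6 (X : Type u) [MetricSpace X] [ProperSpace X] :
    cofinalDim (HigsonCorona X) ≤ (metricCoarseProximity X).coarseCofinalDim := by
  unfold cofinalDim CoarseProximity.coarseCofinalDim
  by_cases hb : Bornology.IsBounded (univ : Set X)
  · rw [if_pos hb, if_pos (isEmpty_higsonCorona hb)]
  rw [if_neg hb]
  by_cases hn : ∃ n, (metricCoarseProximity X).CoarseCofinalDimLE n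
  · have hle : CofinalDimLE (HigsonCorona X)
        (sInf {n | (metricCoarseProximity X).CoarseCofinalDimLE n}) :=
      CoarseProximity.CoarseCofinalDimLE.cofinalDimLE (Nat.sInf_mem hn)
    rw [if_pos hn, if_pos (⟨_, hle⟩ : ∃ n, CofinalDimLE (HigsonCorona X) n)]
    -- Emptiness of the corona need not be ruled out: its value `-1` lies below every natural
    -- number.
    by_cases he : IsEmpty (HigsonCorona X)
    · rw [if_pos he]
      exact WithTop.coe_le_coe.2 (by lia)
    · rw [if_neg he]
      exact WithTop.coe_le_coe.2 (Int.ofNat_le.2 (Nat.sInf_le hle))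
  · rw [if_neg hn]
    exact le_top
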